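/- Probabilistic zero forcing on a finite simple graph $G$ is the following random process. Initially the vertices of a set $S$ are blue and all others are white. At each time step, every blue vertex $u$ forces each of its white neighbors $v$ to become blue, independently over all such pairs $(u,v)$, with probability $C[u]/\deg u$, where $C[u]$ is the number of currently blue vertices in the closed neighborhood of $u$ (including $u$ itself); blue vertices stay blue. The propagation time of $S$ is the number of time steps until all vertices are blue, $\operatorname{ept}(G,S)$ is its expected value, and $\operatorname{ept}(G)=\min_{v\in V(G)}\operatorname{ept}(G,\{v\})$. Theorem. The expected propagation time of the $n$-dimensional hypercube graph $Q_n$ on $2^n$ vertices is $O(n\log n)$: there is an absolute constant $C>0$ such that $\operatorname{ept}(Q_n)\le C\,n\log n$ for all $n\ge 2$. -/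

import Mathlib

open MeasureTheory
open scoped ENNReal

noncomputable section

namespace ProbZeroForcing

/-- The `n`-dimensional hypercube graph: its `2 ^ n` vertices are the binary words of length `n`,
two of them being adjacent when they differ in exactly one coordinate. -/
def hypercube (n : ℕ) : SimpleGraph (Fin n → Bool) where
  Adj x y := hammingDist x y = 1
  symm := ⟨fun x y h => by rw [hammingDist_comm]; exact h⟩
  loopless := ⟨fun x h => by simp at h⟩

instance (n : ℕ) : DecidableRel (hypercube n).Adj :=
  fun x y => inferInstanceAs (Decidable (hammingDist x y = 1))

variable {V : Type*} [Fintype V] [DecidableEq V]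

/-- `C[u]`: the number of blue vertices in the closed neighborhood of `u`, where `B` is the set of
blue vertices. -/
def closedBlueCount (G : SimpleGraph V) [DecidableRel G.Adj] (B : Finset V) (u : V) : ℕ :=
  (B.filter fun w => w = u ∨ G.Adj u w).card

/-- The probability `C[u] / deg u` with which a blue vertex `u` forces a given white neighbor.
(It is only used for a blue `u` that has a white neighbor; it then lies in `(0, 1]`.) -/
def forceProb (G : SimpleGraph V) [DecidableRel G.Adj] (B : Finset V) (u : V) : ℝ :=
  (closedBlueCount G B u : ℝ) / (G.degree u : ℝ)

/-- One time step from the blue set `B`, driven by numbers `x (u, v) ∈ [0, 1]`, one for every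
ordered pair of vertices: blue vertices stay blue, and the blue vertex `u` forces its white
neighbor `v` exactly when `x (u, v) ≤ C[u] / deg u`. -/
def step (G : SimpleGraph V) [DecidableRel G.Adj] (B : Finset V) (x : V × V → unitInterval) :
    Finset V :=
  open Classical in
  B ∪ Finset.univ.filter fun v => ∃ u ∈ B, G.Adj u v ∧ (x (u, v) : ℝ) ≤ forceProb G B u

/-- The sample space: a number in `[0, 1]` for every time step and every ordered pair of
vertices. -/
abbrev Sample (V : Type*) : Type _ := ℕ → V × V → unitInterval

/-- The law of independent uniform random variables on `[0, 1]`, one for every time step and every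
ordered pair of vertices. With it, given the current blue set `B`, each blue `u` forces each white
neighbor `v` with probability `C[u] / deg u`, independently over all such pairs `(u, v)`. -/
def sampleMeasure (V : Type*) [Fintype V] : Measure (Sample V) :=
  Measure.infinitePi fun _ : ℕ =>
    Measure.pi fun _ : V × V => (volume : Measure unitInterval)

/-- The set of blue vertices after `t` time steps, starting from the blue set `S`. -/
def blue (G : SimpleGraph V) [DecidableRel G.Adj] (S : Finset V) (ω : Sample V) : ℕ → Finset V
  | 0 => S
  | t + 1 => step G (blue G S ω t) (ω t)

/-- The propagation time of `S`: the number of time steps until all vertices are blue, `⊤` if this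
never happens. -/
def propTime (G : SimpleGraph V) [DecidableRel G.Adj] (S : Finset V) (ω : Sample V) : ℕ∞ :=
  ⨅ (t : ℕ) (_ : blue G S ω t = Finset.univ), (t : ℕ∞)

/-- The expected propagation time `ept(G, S)` of the initial blue set `S`. -/
def eptFrom (G : SimpleGraph V) [DecidableRel G.Adj] (S : Finset V) : ℝ≥0∞ :=
  ∫⁻ ω, (propTime G S ω : ℝ≥0∞) ∂(sampleMeasure V)

/-- The expected propagation time `ept(G)`: the least expected propagation time of a single initial
blue vertex. -/
def ept (G : SimpleGraph V) [DecidableRel G.Adj] : ℝ≥0∞ :=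
  ⨅ v : V, eptFrom G {v}

end ProbZeroForcing

end

/-!
Around a blue vertex `u` with `k = C[u]`, `w` white neighbors and `d = deg u`, a step forces on
average `w * (k / d)` new vertices, so `C[u]` grows by a factor `1 + Y` with `E Y = w / d`, whatever
`k` is. As a sum of independent indicators divided by `k ≥ 1`, `Y` satisfies `Var Y ≤ E Y`, whence
`E (1 + Y)⁻¹ ≤ 1 - E Y / 4`; since `w / k = (d + 1) / k - 1`, this makes the white-to-blue ratio
`w / k` contract by `3 / 4` in expectation at every step. In a graph of maximum degree `Δ` the ratio
starts at most at `Δ` and is at least `1 / Δ` while a neighbor of `u` is white, so after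
`s = O(log Δ)` steps a given neighbor is white with probability at most `1 / 4`.

Running the process in blocks of `s` steps, the blue part of a walk of length `L` from a blue vertex
to `v` advances by an edge with probability at least `3 / 4` per block, so after `m` blocks `v` is
white with probability at most `4 ^ L * 2 ^ (-m)`. A union bound over the vertices leaves a
geometric tail beyond `O(D + log |V|)` blocks, where `D` is the distance to the farthest vertex; in
the hypercube `Δ`, `D` and `log |V|` are all `O(n)`.
-/

noncomputable section

namespace ProbZeroForcing

open ProbabilityTheory

section Numerics

/-- The quadratic on the right agrees with `1 / (1 + y)` at `0` and to first order at `1`. -/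
lemma one_div_one_add_le {y : ℝ} (hy : 0 ≤ y) : 1 / (1 + y) ≤ 1 - 3 / 4 * y + y ^ 2 / 4 := by
  rw [div_le_iff₀ (by positivity)]
  nlinarith [mul_nonneg hy (sq_nonneg (y - 1))]

lemma sq_mul_three_quarters_pow_le {x : ℝ} (hx : 2 ≤ x) {s : ℕ} (hs : 16 * Real.log x ≤ s) :
    x ^ 2 * (3 / 4) ^ s ≤ 1 / 4 := by
  have hx0 : 0 < x := by linarith
  have hexp : (3 / 4 : ℝ) ≤ Real.exp (-(1 / 4)) := by
    linarith [Real.add_one_le_exp (-(1 / 4))]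
  calc x ^ 2 * (3 / 4) ^ s ≤ x ^ 2 * Real.exp (-(1 / 4)) ^ s := by gcongr
    _ = x ^ 2 * Real.exp (-(s / 4)) := by
        rw [← Real.exp_nat_mul]
        ring_nf
    _ ≤ x ^ 2 * Real.exp (-(4 * Real.log x)) := by
        gcongr
        linarith
    _ = x ^ 2 * (x ^ 4)⁻¹ := by
        rw [Real.exp_neg, mul_comm (4 : ℝ), Real.exp_mul, Real.exp_log hx0]
        norm_cast
    _ = 1 / x ^ 2 := by field_simp
    _ ≤ 1 / 2 ^ 2 := by gcongr
    _ = 1 / 4 := by norm_num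

lemma ceil_sixteen_mul_log_le {x : ℝ} (hx : 2 ≤ x) : ⌈16 * Real.log x⌉₊ ≤ 18 * Real.log x := by
  have hlog : Real.log 2 ≤ Real.log x := Real.log_le_log two_pos hx
  have := Nat.ceil_lt_add_one (a := 16 * Real.log x) (by linarith [Real.log_two_gt_d9])
  linarith [Real.log_two_gt_d9]

lemma clog_two_le (n : ℕ) : Nat.clog 2 n ≤ 2 * Real.log n + 1 := by
  have hlog : 0 ≤ Real.log n := Real.log_natCast_nonneg n
  calc (Nat.clog 2 n : ℝ) = ⌈Real.logb 2 n⌉₊ := by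
        rw [← Real.natCeil_logb_natCast, Nat.cast_two]
    _ ≤ Real.logb 2 n + 1 :=
        (Nat.ceil_lt_add_one (div_nonneg hlog (Real.log_nonneg one_le_two))).le
    _ ≤ 2 * Real.log n + 1 := by
        gcongr
        rw [Real.logb, div_le_iff₀ (Real.log_pos one_lt_two)]
        nlinarith [Real.log_two_gt_d9]

lemma mul_four_pow_le_two_pow (c D : ℕ) : c * 4 ^ D ≤ 2 ^ (2 * D + Nat.clog 2 c) := by
  rw [pow_add, pow_mul, mul_comm]
  exact Nat.mul_le_mul_left _ (Nat.le_pow_clog one_lt_two c)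

lemma tsum_le_of_le_geometric {a : ℕ → ℝ≥0∞} {N : ℕ} (hone : ∀ m, a m ≤ 1)
    (hgeom : ∀ m, a m ≤ 2 ^ N * 2⁻¹ ^ m) : ∑' m, a m ≤ N + 2 := by
  rw [← ENNReal.summable.sum_add_tsum_nat_add' (k := N)]
  gcongr
  · exact (Finset.sum_le_sum fun m _ => hone m).trans (by simp)
  · calc ∑' m, a (m + N) ≤ ∑' m, 2⁻¹ ^ m := by
          refine ENNReal.tsum_le_tsum fun m => (hgeom _).trans_eq ?_
          rw [pow_add, mul_left_comm, ← mul_pow, ENNReal.mul_inv_cancel (by simp) (by simp),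
            one_pow, mul_one]
      _ = 2 := ENNReal.tsum_geometric_two

end Numerics

section Moments

variable {Ω : Type*} [MeasurableSpace Ω] {P : Measure Ω} [IsProbabilityMeasure P]

lemma variance_sum_le_integral_sum {ι : Type*} {X : ι → Ω → ℝ} {s : Finset ι}
    (hX : ∀ i ∈ s, AEMeasurable (X i) P) (h01 : ∀ i ∈ s, ∀ᵐ ω ∂P, X i ω ∈ Set.Icc 0 1)
    (hind : (s : Set ι).Pairwise fun i j => X i ⟂ᵢ[P] X j) :
    Var[∑ i ∈ s, X i; P] ≤ P[∑ i ∈ s, X i] := by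
  have hL2 : ∀ i ∈ s, MemLp (X i) 2 P := fun i hi =>
    memLp_of_bounded (h01 i hi) (hX i hi).aestronglyMeasurable 2
  rw [IndepFun.variance_sum hL2 hind]
  simp only [Finset.sum_apply]
  rw [integral_finsetSum s fun i hi => (hL2 i hi).integrable one_le_two]
  refine Finset.sum_le_sum fun i hi => ?_
  calc Var[X i; P] ≤ (1 - P[X i]) * (P[X i] - 0) := variance_le_sub_mul_sub (h01 i hi) (hX i hi)
    _ ≤ P[X i] := by nlinarith [sq_nonneg P[X i]]

lemma integrable_one_div_one_add {Y : Ω → ℝ} (hY : AEMeasurable Y P) (h0 : 0 ≤ᵐ[P] Y) :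
    Integrable (fun ω => 1 / (1 + Y ω)) P := by
  refine .of_mem_Icc 0 1 ((hY.const_add 1).const_div 1) ?_
  filter_upwards [h0] with ω (hω : 0 ≤ Y ω)
  exact ⟨by positivity, div_le_one_of_le₀ (by linarith) (by positivity)⟩

lemma integral_one_div_one_add_le {Y : Ω → ℝ} (hY : MemLp Y 2 P) (h0 : 0 ≤ᵐ[P] Y)
    (hvar : Var[Y; P] ≤ P[Y]) (hY1 : P[Y] ≤ 1) :
    ∫ ω, 1 / (1 + Y ω) ∂P ≤ 1 - P[Y] / 4 := by
  have hint : Integrable Y P := hY.integrable one_le_two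
  have hsq : ∫ ω, Y ω ^ 2 ∂P ≤ P[Y] ^ 2 + P[Y] := by
    have := variance_eq_sub hY
    simp only [Pi.pow_apply] at this
    linarith
  have hmean : 0 ≤ P[Y] := integral_nonneg_of_ae h0
  have hlin : Integrable (fun ω => 1 - 3 / 4 * Y ω) P :=
    (integrable_const 1).sub (hint.const_mul _)
  calc ∫ ω, 1 / (1 + Y ω) ∂P ≤ ∫ ω, (1 - 3 / 4 * Y ω + Y ω ^ 2 / 4) ∂P := by
        refine integral_mono_ae (integrable_one_div_one_add hint.aemeasurable h0)
          (hlin.add (hY.integrable_sq.div_const 4)) ?_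
        filter_upwards [h0] with ω hω using one_div_one_add_le hω
    _ = 1 - 3 / 4 * P[Y] + (∫ ω, Y ω ^ 2 ∂P) / 4 := by
        rw [integral_add hlin (hY.integrable_sq.div_const 4),
          integral_sub (integrable_const 1) (hint.const_mul _), integral_const_mul, integral_div]
        simp
    _ ≤ 1 - P[Y] / 4 := by nlinarith

end Moments

section LeIndicator

/-- The indicator of `[0, q]` as a function on the unit interval: evaluated at a uniform number, it
is the Bernoulli variable of parameter `q` that decides whether a vertex is forced. -/
def leIndicator (q : ℝ) : unitInterval → ℝ := {y : unitInterval | (y : ℝ) ≤ q}.indicator 1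

lemma measurable_leIndicator (q : ℝ) : Measurable (leIndicator q) :=
  measurable_one.indicator (measurableSet_le measurable_subtype_coe measurable_const)

lemma measurable_leIndicator_eval {ι : Type*} (q : ℝ) (i : ι) :
    Measurable fun x : ι → unitInterval => leIndicator q (x i) :=
  (measurable_leIndicator q).comp (measurable_pi_apply i)

lemma leIndicator_mem_Icc (q : ℝ) (y : unitInterval) : leIndicator q y ∈ Set.Icc 0 1 := by
  by_cases hy : (y : ℝ) ≤ q <;> simp [leIndicator, hy]

lemma integral_leIndicator {q : ℝ} (hq : q ∈ Set.Icc 0 1) : ∫ y, leIndicator q y = q := by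
  have hset : {y : unitInterval | (y : ℝ) ≤ q} = Set.Iic ⟨q, hq⟩ := rfl
  rw [leIndicator, hset, integral_indicator_one measurableSet_Iic, measureReal_def,
    unitInterval.volume_Iic, ENNReal.toReal_ofReal hq.1]

end LeIndicator

section Cylinder

variable {ι : Type*} {X : ι → Type*} [∀ i, MeasurableSpace (X i)]

lemma indep_cylinderEvents (μ : ∀ i, Measure (X i)) [∀ i, IsProbabilityMeasure (μ i)]
    {S T : Set ι} (hST : Disjoint S T) :
    Indep (cylinderEvents S) (cylinderEvents T) (Measure.infinitePi μ) :=
  indep_iSup_of_disjoint (fun i => (measurable_pi_apply i).comap_le)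
    ((iIndepFun_iff_iIndep _ _ _).1 (iIndepFun_infinitePi (P := μ) fun _ => measurable_id)) hST

end Cylinder

variable {V : Type*} [Fintype V]

instance : IsProbabilityMeasure (sampleMeasure V) := by
  unfold sampleMeasure
  infer_instance

lemma map_eval_sampleMeasure (t : ℕ) : (sampleMeasure V).map (fun ω => ω t) = volume :=
  Measure.infinitePi_map_eval _ t

variable [DecidableEq V]

section Markov

variable (G : SimpleGraph V) [DecidableRel G.Adj]

lemma subset_step (B : Finset V) (x : V × V → unitInterval) : B ⊆ step G B x :=
  Finset.subset_union_left

lemma subset_blue (B : Finset V) (ω : Sample V) (t : ℕ) : B ⊆ blue G B ω t := by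
  induction t with
  | zero => exact subset_rfl
  | succ t ih => exact ih.trans (subset_step G _ _)

lemma measurable_step (B : Finset V) : Measurable (step G B) := by
  classical
  rw [measurable_finset_iff]
  intro v
  simp only [step, Finset.mem_union, Finset.mem_filter, Finset.mem_univ, true_and]
  refine measurable_const.or (Measurable.exists fun u => ?_)
  refine measurable_const.and (measurable_const.and ?_)
  exact measurableSet_setOfPred.1 (measurableSet_le (by fun_prop) measurable_const)

lemma measurable_step_uncurry :
    Measurable fun p : Finset V × (V × V → unitInterval) => step G p.1 p.2 :=
  measurable_from_prod_countable_right (measurable_step G)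

lemma measurable_blue_cylinderEvents (B : Finset V) (t : ℕ) :
    Measurable[cylinderEvents (Set.Iio t)] fun ω : Sample V => blue G B ω t := by
  induction t with
  | zero => exact measurable_const
  | succ t ih =>
    have hpast : Measurable[cylinderEvents (Set.Iio (t + 1))] fun ω : Sample V => blue G B ω t :=
      ih.mono (cylinderEvents_mono (Set.Iio_subset_Iio t.le_succ)) le_rfl
    have hnew : Measurable[cylinderEvents (Set.Iio (t + 1))] fun ω : Sample V => ω t :=
      measurable_cylinderEvent_apply (Set.mem_Iio.2 t.lt_succ_self)
    simpa only [blue, Function.comp_def] using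
      (measurable_step_uncurry G).comp (hpast.prodMk hnew)

lemma measurable_blue (B : Finset V) (t : ℕ) : Measurable fun ω : Sample V => blue G B ω t :=
  (measurable_blue_cylinderEvents G B t).mono cylinderEvents_le_pi le_rfl

lemma indepFun_blue_eval (B : Finset V) (t : ℕ) :
    (fun ω : Sample V => blue G B ω t) ⟂ᵢ[sampleMeasure V] fun ω => ω t := by
  have hdisj : Disjoint (Set.Iio t) {t} := by simp
  rw [IndepFun_iff_Indep]
  exact indep_of_indep_of_le_right
    (indep_of_indep_of_le_left (indep_cylinderEvents _ hdisj)
      (measurable_blue_cylinderEvents G B t).comap_le)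
    (measurable_cylinderEvent_apply (Set.mem_singleton t)).comap_le

/-- The expected value of `f` at the set of blue vertices reached from `B` after `t` steps, as a
function of `B`; that is, the `t`-th power of the transition operator of the process. -/
def expectBlue (t : ℕ) (f : Finset V → ℝ≥0∞) (B : Finset V) : ℝ≥0∞ :=
  ∫⁻ ω, f (blue G B ω t) ∂sampleMeasure V

lemma expectBlue_zero (f : Finset V → ℝ≥0∞) : expectBlue G 0 f = f := by
  ext B
  simp [expectBlue, blue]

lemma expectBlue_one (f : Finset V → ℝ≥0∞) (B : Finset V) :
    expectBlue G 1 f B = ∫⁻ x, f (step G B x) := by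
  have hstep : Measurable fun x => f (step G B x) :=
    (measurable_of_countable f).comp (measurable_step G B)
  rw [← map_eval_sampleMeasure 0, lintegral_map hstep (measurable_pi_apply 0)]
  rfl

lemma expectBlue_succ (t : ℕ) (f : Finset V → ℝ≥0∞) :
    expectBlue G (t + 1) f = expectBlue G t (expectBlue G 1 f) := by
  ext B
  have hblue := measurable_blue G B t
  have heval : Measurable fun ω : Sample V => ω t := measurable_pi_apply t
  have hstep : Measurable fun p : Finset V × (V × V → unitInterval) => f (step G p.1 p.2) :=
    (measurable_of_countable f).comp (measurable_step_uncurry G)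
  have hprod := (indepFun_iff_map_prod_eq_prod_map_map hblue.aemeasurable heval.aemeasurable).1
    (indepFun_blue_eval G B t)
  calc expectBlue G (t + 1) f B
      = ∫⁻ p, f (step G p.1 p.2) ∂(sampleMeasure V).map fun ω => (blue G B ω t, ω t) :=
        (lintegral_map hstep (hblue.prodMk heval)).symm
    _ = ∫⁻ B', expectBlue G 1 f B' ∂(sampleMeasure V).map fun ω => blue G B ω t := by
        rw [hprod, map_eval_sampleMeasure, lintegral_prod _ hstep.aemeasurable]
        simp only [expectBlue_one]
    _ = expectBlue G t (expectBlue G 1 f) B := lintegral_map (measurable_of_countable _) hblue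

lemma expectBlue_add (s t : ℕ) (f : Finset V → ℝ≥0∞) :
    expectBlue G (s + t) f = expectBlue G s (expectBlue G t f) := by
  induction t generalizing f with
  | zero => rw [add_zero, expectBlue_zero]
  | succ t ih => rw [← add_assoc, expectBlue_succ, ih, ← expectBlue_succ]

variable {G}

lemma expectBlue_mono {f g : Finset V → ℝ≥0∞} {B : Finset V} (t : ℕ)
    (h : ∀ B', B ⊆ B' → f B' ≤ g B') : expectBlue G t f B ≤ expectBlue G t g B :=
  lintegral_mono fun ω => h _ (subset_blue G B ω t)

lemma expectBlue_const_mul (t : ℕ) (c : ℝ≥0∞) (f : Finset V → ℝ≥0∞) (B : Finset V) :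
    expectBlue G t (fun B' => c * f B') B = c * expectBlue G t f B :=
  lintegral_const_mul c ((measurable_of_countable f).comp (measurable_blue G B t))

lemma expectBlue_const_add (t : ℕ) (c : ℝ≥0∞) (f : Finset V → ℝ≥0∞) (B : Finset V) :
    expectBlue G t (fun B' => c + f B') B = c + expectBlue G t f B := by
  rw [expectBlue, lintegral_add_left measurable_const, lintegral_const, measure_univ, mul_one,
    expectBlue]

lemma expectBlue_le_pow_mul {f : Finset V → ℝ≥0∞} {c : ℝ≥0∞} {B : Finset V}
    (h : ∀ B', B ⊆ B' → expectBlue G 1 f B' ≤ c * f B') (t : ℕ) :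
    expectBlue G t f B ≤ c ^ t * f B := by
  induction t with
  | zero => simp [expectBlue_zero]
  | succ t ih =>
    calc expectBlue G (t + 1) f B
        = expectBlue G t (expectBlue G 1 f) B := by rw [expectBlue_succ]
      _ ≤ expectBlue G t (fun B' => c * f B') B := expectBlue_mono t h
      _ = c * expectBlue G t f B := expectBlue_const_mul t c f B
      _ ≤ c * (c ^ t * f B) := by gcongr
      _ = c ^ (t + 1) * f B := by ring

end Markov

section WhiteProb

variable (G : SimpleGraph V) [DecidableRel G.Adj]

/-- The probability that the vertex `v` is still white `t` steps after the blue set was `B`. -/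
def whiteProb (t : ℕ) (v : V) (B : Finset V) : ℝ≥0∞ :=
  sampleMeasure V {ω | v ∉ blue G B ω t}

lemma whiteProb_eq_expectBlue (t : ℕ) (v : V) :
    whiteProb G t v = expectBlue G t ({B | v ∉ B}.indicator 1) := by
  ext B
  exact (lintegral_indicator_one
    (measurable_blue G B t (Set.to_countable {B | v ∉ B}).measurableSet)).symm

lemma whiteProb_add (s t : ℕ) (v : V) :
    whiteProb G (s + t) v = expectBlue G s (whiteProb G t v) := by
  rw [whiteProb_eq_expectBlue, whiteProb_eq_expectBlue, expectBlue_add]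

lemma whiteProb_le_one (t : ℕ) (v : V) (B : Finset V) : whiteProb G t v B ≤ 1 :=
  prob_le_one

variable {G}

lemma whiteProb_eq_zero {v : V} {B : Finset V} (hv : v ∈ B) (t : ℕ) : whiteProb G t v B = 0 := by
  have hblue : {ω : Sample V | v ∉ blue G B ω t} = ∅ :=
    Set.eq_empty_of_forall_notMem fun ω h => h (subset_blue G B ω t hv)
  rw [whiteProb, hblue, measure_empty]

lemma expectBlue_le_add_mul_whiteProb {f : Finset V → ℝ≥0∞} {a b : ℝ≥0∞} {v : V} {B : Finset V}
    (ha : ∀ B', v ∈ B' → f B' ≤ a) (hb : ∀ B', B ⊆ B' → f B' ≤ b) (t : ℕ) :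
    expectBlue G t f B ≤ a + b * whiteProb G t v B := by
  rw [whiteProb_eq_expectBlue, ← expectBlue_const_mul, ← expectBlue_const_add]
  refine expectBlue_mono t fun B' hB' => ?_
  by_cases hv : v ∈ B'
  · exact (ha B' hv).trans le_self_add
  · simpa [hv] using (hb B' hB').trans le_add_self

/-- Each block of `s` steps extends the blue part of the walk by one edge with probability at least
`3 / 4`. -/
lemma whiteProb_le_of_walk {s : ℕ}
    (h : ∀ ⦃u v B⦄, G.Adj u v → u ∈ B → whiteProb G s v B ≤ 4⁻¹) {u v : V} (p : G.Walk u v)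
    {B : Finset V} (hu : u ∈ B) (m : ℕ) :
    whiteProb G (s * m) v B ≤ 4 ^ p.length * 2⁻¹ ^ m := by
  induction m generalizing u B with
  | zero =>
    rw [pow_zero, mul_one]
    exact (whiteProb_le_one G _ v B).trans (one_le_pow₀ (by norm_num))
  | succ m ih =>
    cases p with
    | nil => rw [whiteProb_eq_zero hu]; exact zero_le
    | @cons _ y _ huy p =>
      have hfour : (1 : ℝ≥0∞) + 4 * 4⁻¹ = 4 * 2⁻¹ := by
        rw [ENNReal.mul_inv_cancel (by simp) (by simp), show (4 : ℝ≥0∞) = 2 * 2 by norm_num,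
          mul_assoc, ENNReal.mul_inv_cancel (by simp) (by simp), mul_one, one_add_one_eq_two]
      calc whiteProb G (s * (m + 1)) v B
          = expectBlue G s (whiteProb G (s * m) v) B := by
            rw [mul_add_one, add_comm, whiteProb_add]
        _ ≤ 4 ^ p.length * 2⁻¹ ^ m + 4 ^ (p.length + 1) * 2⁻¹ ^ m * whiteProb G s y B :=
            expectBlue_le_add_mul_whiteProb (fun B' hy => ih p hy)
              (fun B' hB' => ih (.cons huy p) (hB' hu)) s
        _ ≤ 4 ^ p.length * 2⁻¹ ^ m + 4 ^ (p.length + 1) * 2⁻¹ ^ m * 4⁻¹ := by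
            gcongr
            exact h huy hu
        _ = 4 ^ p.length * 2⁻¹ ^ m * (1 + 4 * 4⁻¹) := by ring
        _ = 4 ^ p.length * 2⁻¹ ^ m * (4 * 2⁻¹) := by rw [hfour]
        _ = 4 ^ (p.length + 1) * 2⁻¹ ^ (m + 1) := by ring

end WhiteProb

section WhiteRatio

/-- The neighbors of `u` outside the blue set `B`. -/
def whiteNeighbors (G : SimpleGraph V) [DecidableRel G.Adj] (B : Finset V) (u : V) : Finset V :=
  G.neighborFinset u \ B

/-- The number of white neighbors of `u` divided by the number `C[u]` of blue vertices in its closed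
neighborhood; it is used for blue `u`, when the denominator is positive. -/
def whiteRatio (G : SimpleGraph V) [DecidableRel G.Adj] (B : Finset V) (u : V) : ℝ :=
  (whiteNeighbors G B u).card / closedBlueCount G B u

/-- The number of white neighbors that `u` forces in a step from `B` driven by `x`, as a sum of
independent Bernoulli variables. -/
def forcedCount (G : SimpleGraph V) [DecidableRel G.Adj] (B : Finset V) (u : V)
    (x : V × V → unitInterval) : ℝ :=
  ∑ v ∈ whiteNeighbors G B u, leIndicator (forceProb G B u) (x (u, v))

variable {G : SimpleGraph V} [DecidableRel G.Adj] {B : Finset V} {u v : V}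

omit [Fintype V] in
lemma closedBlueCount_pos (hu : u ∈ B) : 0 < closedBlueCount G B u :=
  Finset.card_pos.2 ⟨u, by simp [hu]⟩

lemma card_whiteNeighbors_add_closedBlueCount (hu : u ∈ B) :
    (whiteNeighbors G B u).card + closedBlueCount G B u = G.degree u + 1 := by
  have hunion : insert u (G.neighborFinset u) =
      whiteNeighbors G B u ∪ B.filter fun w => w = u ∨ G.Adj u w := by
    ext w
    by_cases hw : w = u
    · simp [hw, hu]
    · simp only [whiteNeighbors, Finset.mem_insert, hw, Finset.mem_union, Finset.mem_sdiff,
        SimpleGraph.mem_neighborFinset, Finset.mem_filter]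
      tauto
  have hdisj : Disjoint (whiteNeighbors G B u) (B.filter fun w => w = u ∨ G.Adj u w) :=
    Finset.disjoint_of_subset_right (Finset.filter_subset _ _) Finset.sdiff_disjoint
  rw [closedBlueCount, ← Finset.card_union_of_disjoint hdisj, ← hunion,
    Finset.card_insert_of_notMem (by simp), SimpleGraph.card_neighborFinset_eq_degree]

lemma card_whiteNeighbors_le_degree : (whiteNeighbors G B u).card ≤ G.degree u :=
  (Finset.card_le_card Finset.sdiff_subset).trans_eq (G.card_neighborFinset_eq_degree u)

lemma whiteRatio_eq (hu : u ∈ B) :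
    whiteRatio G B u = (G.degree u + 1) / closedBlueCount G B u - 1 := by
  have hk : (closedBlueCount G B u : ℝ) ≠ 0 := by exact_mod_cast (closedBlueCount_pos hu).ne'
  rw [whiteRatio, eq_sub_iff_add_eq, div_add_one hk]
  exact_mod_cast congr_arg (fun m : ℕ => (m : ℝ) / closedBlueCount G B u)
    (card_whiteNeighbors_add_closedBlueCount hu)

lemma whiteRatio_nonneg : 0 ≤ whiteRatio G B u := by
  unfold whiteRatio
  positivity

lemma whiteRatio_le_degree (hu : u ∈ B) : whiteRatio G B u ≤ G.degree u :=
  (div_le_self (Nat.cast_nonneg _) (by exact_mod_cast closedBlueCount_pos hu)).trans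
    (by exact_mod_cast card_whiteNeighbors_le_degree)

lemma whiteRatio_le_mul_card_div_degree :
    whiteRatio G B u ≤ (G.degree u + 1) / closedBlueCount G B u *
      ((whiteNeighbors G B u).card / G.degree u) := by
  have hwd := card_whiteNeighbors_le_degree (G := G) (B := B) (u := u)
  unfold whiteRatio
  obtain hd | hd := (G.degree u).eq_zero_or_pos
  · simp [Nat.eq_zero_of_le_zero (hd ▸ hwd)]
  · rw [div_mul_div_comm, mul_comm (closedBlueCount G B u : ℝ), ← div_div]
    gcongr
    rw [le_div_iff₀ (by positivity)]
    nlinarith [(whiteNeighbors G B u).card.cast_nonneg (α := ℝ)]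

lemma closedBlueCount_le_degree (hu : u ∈ B) (hv : v ∈ whiteNeighbors G B u) :
    closedBlueCount G B u ≤ G.degree u := by
  have hcard := card_whiteNeighbors_add_closedBlueCount (G := G) hu
  have hpos := Finset.card_pos.2 ⟨v, hv⟩
  omega

lemma one_le_degree_mul_whiteRatio (hu : u ∈ B) (hv : v ∈ whiteNeighbors G B u) :
    1 ≤ G.degree u * whiteRatio G B u := by
  have hk : (0 : ℝ) < closedBlueCount G B u := by exact_mod_cast closedBlueCount_pos hu
  have hkd : (closedBlueCount G B u : ℝ) ≤ G.degree u := by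
    exact_mod_cast closedBlueCount_le_degree hu hv
  have hw : (1 : ℝ) ≤ (whiteNeighbors G B u).card := by exact_mod_cast Finset.card_pos.2 ⟨v, hv⟩
  rw [whiteRatio, mul_div_assoc', one_le_div hk]
  exact hkd.trans (le_mul_of_one_le_right (Nat.cast_nonneg _) hw)

lemma forceProb_mem_Icc (hu : u ∈ B) (hv : v ∈ whiteNeighbors G B u) :
    forceProb G B u ∈ Set.Icc 0 1 :=
  ⟨div_nonneg (Nat.cast_nonneg _) (Nat.cast_nonneg _),
    div_le_one_of_le₀ (by exact_mod_cast closedBlueCount_le_degree hu hv) (Nat.cast_nonneg _)⟩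

lemma forcedCount_nonneg (x : V × V → unitInterval) : 0 ≤ forcedCount G B u x :=
  Finset.sum_nonneg fun _ _ => (leIndicator_mem_Icc _ _).1

lemma closedBlueCount_add_forcedCount_le (hu : u ∈ B) (x : V × V → unitInterval) :
    closedBlueCount G B u + forcedCount G B u x ≤ closedBlueCount G (step G B x) u := by
  have hforced : forcedCount G B u x =
      ((whiteNeighbors G B u).filter fun v => (x (u, v) : ℝ) ≤ forceProb G B u).card := by
    simp [forcedCount, leIndicator, Set.indicator_apply]
  rw [hforced]
  norm_cast
  unfold closedBlueCount
  rw [← Finset.card_union_of_disjoint]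
  · refine Finset.card_le_card fun v hv => ?_
    simp only [Finset.mem_union, Finset.mem_filter, whiteNeighbors, Finset.mem_sdiff,
      SimpleGraph.mem_neighborFinset, step, Finset.mem_univ, true_and] at hv ⊢
    rcases hv with hv | hv
    · exact ⟨Or.inl hv.1, hv.2⟩
    · exact ⟨Or.inr ⟨u, hu, hv.1.1, hv.2⟩, Or.inr hv.1.1⟩
  · refine Finset.disjoint_left.2 fun v hv hv' => ?_
    simp only [Finset.mem_filter, whiteNeighbors, Finset.mem_sdiff] at hv hv'
    exact hv'.1.2 hv.1

lemma memLp_forcedCount : MemLp (forcedCount G B u) 2 :=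
  memLp_finsetSum _ fun v _ => memLp_of_bounded
    (ae_of_all _ fun _ => leIndicator_mem_Icc _ _)
    (measurable_leIndicator_eval _ (u, v)).aestronglyMeasurable 2

lemma integral_forcedCount (hu : u ∈ B) :
    ∫ x, forcedCount G B u x = (whiteNeighbors G B u).card * forceProb G B u := by
  have hint (v : V) : ∫ x : V × V → unitInterval, leIndicator (forceProb G B u) (x (u, v)) =
      ∫ y, leIndicator (forceProb G B u) y :=
    integral_comp_eval (measurable_leIndicator _).aestronglyMeasurable
  simp only [forcedCount]
  rw [integral_finsetSum _ fun v _ => Integrable.of_mem_Icc 0 1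
    (measurable_leIndicator_eval _ (u, v)).aemeasurable
    (ae_of_all _ fun _ => leIndicator_mem_Icc _ _)]
  rw [Finset.sum_congr rfl fun v hv =>
    (hint v).trans (integral_leIndicator (forceProb_mem_Icc hu hv)), Finset.sum_const, nsmul_eq_mul]

lemma variance_forcedCount_le :
    Var[forcedCount G B u; volume] ≤ ∫ x, forcedCount G B u x := by
  have hind : iIndepFun (fun (i : V × V) (x : V × V → unitInterval) =>
      leIndicator (forceProb G B u) (x i)) volume :=
    iIndepFun_pi fun _ => (measurable_leIndicator _).aemeasurable
  have hsum : forcedCount G B u =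
      ∑ v ∈ whiteNeighbors G B u, fun x => leIndicator (forceProb G B u) (x (u, v)) := by
    ext x
    simp [forcedCount]
  rw [hsum]
  exact variance_sum_le_integral_sum
    (fun v _ => (measurable_leIndicator_eval _ (u, v)).aemeasurable)
    (fun _ _ => ae_of_all _ fun _ => leIndicator_mem_Icc _ _)
    (fun v _ w _ hvw => hind.indepFun (by simpa using hvw))

lemma whiteRatio_step_le (hu : u ∈ B) (x : V × V → unitInterval) :
    whiteRatio G (step G B x) u ≤ (G.degree u + 1) / closedBlueCount G B u *
      (1 / (1 + forcedCount G B u x / closedBlueCount G B u)) - 1 := by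
  have hk : (0 : ℝ) < closedBlueCount G B u := by exact_mod_cast closedBlueCount_pos hu
  have hN := forcedCount_nonneg (G := G) (B := B) (u := u) x
  rw [whiteRatio_eq (subset_step G B x hu), div_mul_div_comm, mul_one, mul_one_add,
    mul_div_cancel₀ _ hk.ne']
  gcongr
  exact closedBlueCount_add_forcedCount_le hu x

lemma integral_forcedCount_div (hu : u ∈ B) :
    ∫ x, forcedCount G B u x / closedBlueCount G B u =
      (whiteNeighbors G B u).card / G.degree u := by
  have hk : (closedBlueCount G B u : ℝ) ≠ 0 := by exact_mod_cast (closedBlueCount_pos hu).ne'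
  rw [integral_div, integral_forcedCount hu, forceProb]
  field_simp

lemma memLp_forcedCount_div :
    MemLp (fun x => forcedCount G B u x / closedBlueCount G B u) 2 := by
  simpa only [div_eq_inv_mul] using memLp_forcedCount.const_mul _

lemma forcedCount_div_nonneg (x : V × V → unitInterval) :
    0 ≤ forcedCount G B u x / closedBlueCount G B u :=
  div_nonneg (forcedCount_nonneg x) (Nat.cast_nonneg _)

lemma variance_forcedCount_div_le (hu : u ∈ B) :
    Var[fun x => forcedCount G B u x / closedBlueCount G B u; volume] ≤
      ∫ x, forcedCount G B u x / closedBlueCount G B u := by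
  have hk : (1 : ℝ) ≤ closedBlueCount G B u := by exact_mod_cast closedBlueCount_pos hu
  have hinv : (closedBlueCount G B u : ℝ)⁻¹ ^ 2 ≤ (closedBlueCount G B u : ℝ)⁻¹ :=
    pow_le_of_le_one (by positivity) (inv_le_one_of_one_le₀ hk) two_ne_zero
  simp only [div_eq_inv_mul]
  rw [variance_const_mul, integral_const_mul]
  exact mul_le_mul hinv variance_forcedCount_le (variance_nonneg _ _) (by positivity)

lemma integral_one_div_one_add_forcedCount_le (hu : u ∈ B) :
    ∫ x, 1 / (1 + forcedCount G B u x / closedBlueCount G B u) ≤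
      1 - (whiteNeighbors G B u).card / G.degree u / 4 := by
  have hmean := integral_forcedCount_div (G := G) hu
  rw [← hmean]
  refine integral_one_div_one_add_le memLp_forcedCount_div (ae_of_all _ forcedCount_div_nonneg)
    (variance_forcedCount_div_le hu) ?_
  rw [hmean]
  exact div_le_one_of_le₀ (by exact_mod_cast card_whiteNeighbors_le_degree) (Nat.cast_nonneg _)

lemma integrable_whiteRatio_step : Integrable fun x => whiteRatio G (step G B x) u :=
  Integrable.of_finite.comp_measurable (g := fun B' => whiteRatio G B' u) (measurable_step G B)

lemma integral_whiteRatio_step_le (hu : u ∈ B) :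
    ∫ x, whiteRatio G (step G B x) u ≤ 3 / 4 * whiteRatio G B u := by
  have hloss := whiteRatio_le_mul_card_div_degree (G := G) (B := B) (u := u)
  have hint : Integrable fun x => (G.degree u + 1) / (closedBlueCount G B u : ℝ) *
      (1 / (1 + forcedCount G B u x / closedBlueCount G B u)) := by
    exact (integrable_one_div_one_add memLp_forcedCount_div.aestronglyMeasurable.aemeasurable
      (ae_of_all _ forcedCount_div_nonneg)).const_mul _
  calc ∫ x, whiteRatio G (step G B x) u
      ≤ ∫ x, ((G.degree u + 1) / (closedBlueCount G B u : ℝ) *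
          (1 / (1 + forcedCount G B u x / closedBlueCount G B u)) - 1) :=
        integral_mono integrable_whiteRatio_step (hint.sub (integrable_const 1))
          (whiteRatio_step_le hu)
    _ = (G.degree u + 1) / closedBlueCount G B u *
          (∫ x, 1 / (1 + forcedCount G B u x / closedBlueCount G B u)) - 1 := by
        rw [integral_sub hint (integrable_const 1), integral_const_mul]
        simp
    _ ≤ (G.degree u + 1) / closedBlueCount G B u *
          (1 - (whiteNeighbors G B u).card / G.degree u / 4) - 1 := by
        gcongr
        exact integral_one_div_one_add_forcedCount_le hu
    _ ≤ 3 / 4 * whiteRatio G B u := by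
        linarith [whiteRatio_eq (G := G) hu]

lemma expectBlue_one_whiteRatio_le (hu : u ∈ B) :
    expectBlue G 1 (fun B' => ENNReal.ofReal (whiteRatio G B' u)) B ≤
      ENNReal.ofReal (3 / 4) * ENNReal.ofReal (whiteRatio G B u) := by
  rw [expectBlue_one, ← ofReal_integral_eq_lintegral_ofReal integrable_whiteRatio_step
    (ae_of_all _ fun _ => whiteRatio_nonneg), ← ENNReal.ofReal_mul (by norm_num)]
  exact ENNReal.ofReal_le_ofReal (integral_whiteRatio_step_le hu)

lemma indicator_notMem_le_degree_mul_whiteRatio (hu : u ∈ B) (huv : G.Adj u v) :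
    {B : Finset V | v ∉ B}.indicator 1 B ≤
      ENNReal.ofReal (G.degree u) * ENNReal.ofReal (whiteRatio G B u) := by
  by_cases hv : v ∈ B
  · simp [hv]
  · have hvw : v ∈ whiteNeighbors G B u := by simp [whiteNeighbors, huv, hv]
    rw [Set.indicator_of_mem hv, Pi.one_apply, ← ENNReal.ofReal_mul (Nat.cast_nonneg _),
      ENNReal.one_le_ofReal]
    exact one_le_degree_mul_whiteRatio hu hvw

lemma whiteProb_le_of_adj (hu : u ∈ B) (huv : G.Adj u v) (t : ℕ) :
    whiteProb G t v B ≤ ENNReal.ofReal ((G.degree u : ℝ) ^ 2 * (3 / 4) ^ t) := by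
  calc whiteProb G t v B
      ≤ expectBlue G t (fun B' =>
          ENNReal.ofReal (G.degree u) * ENNReal.ofReal (whiteRatio G B' u)) B := by
        rw [whiteProb_eq_expectBlue]
        exact expectBlue_mono t fun B' hB' =>
          indicator_notMem_le_degree_mul_whiteRatio (hB' hu) huv
    _ = ENNReal.ofReal (G.degree u) *
          expectBlue G t (fun B' => ENNReal.ofReal (whiteRatio G B' u)) B :=
        expectBlue_const_mul ..
    _ ≤ ENNReal.ofReal (G.degree u) *
          (ENNReal.ofReal (3 / 4) ^ t * ENNReal.ofReal (whiteRatio G B u)) := by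
        gcongr
        exact expectBlue_le_pow_mul (fun B' hB' => expectBlue_one_whiteRatio_le (hB' hu)) t
    _ ≤ ENNReal.ofReal (G.degree u) *
          (ENNReal.ofReal (3 / 4) ^ t * ENNReal.ofReal (G.degree u)) := by
        gcongr
        exact whiteRatio_le_degree hu
    _ = ENNReal.ofReal ((G.degree u : ℝ) ^ 2 * (3 / 4) ^ t) := by
        rw [← ENNReal.ofReal_pow (by norm_num), ← ENNReal.ofReal_mul (by positivity),
          ← ENNReal.ofReal_mul (by positivity)]
        ring_nf

lemma whiteProb_ceil_log_le {Δ : ℕ} (hΔ : 2 ≤ Δ) (hdeg : ∀ u, G.degree u ≤ Δ)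
    (hu : u ∈ B) (huv : G.Adj u v) :
    whiteProb G ⌈16 * Real.log Δ⌉₊ v B ≤ 4⁻¹ := by
  set s := ⌈16 * Real.log Δ⌉₊
  calc whiteProb G s v B
      ≤ ENNReal.ofReal ((G.degree u : ℝ) ^ 2 * (3 / 4) ^ s) := whiteProb_le_of_adj hu huv s
    _ ≤ ENNReal.ofReal ((Δ : ℝ) ^ 2 * (3 / 4) ^ s) := by
        gcongr
        exact hdeg u
    _ ≤ ENNReal.ofReal (1 / 4) := ENNReal.ofReal_le_ofReal
        (sq_mul_three_quarters_pow_le (by exact_mod_cast hΔ) (Nat.le_ceil _))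
    _ = 4⁻¹ := by
        rw [one_div, ENNReal.ofReal_inv_of_pos (by norm_num), ENNReal.ofReal_ofNat]

end WhiteRatio

section PropTime

variable {G : SimpleGraph V} [DecidableRel G.Adj] {S : Finset V}

lemma propTime_le_tsum {s : ℕ} (hs : 0 < s) (ω : Sample V) :
    (propTime G S ω : ℝ≥0∞) ≤
      s * ∑' m : ℕ, {ω | blue G S ω (s * m) ≠ Finset.univ}.indicator 1 ω := by
  by_cases h : ∃ m, blue G S ω (s * m) = Finset.univ
  · have hprop : propTime G S ω ≤ ((s * Nat.find h : ℕ) : ℕ∞) :=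
      iInf₂_le (f := fun (t : ℕ) (_ : blue G S ω t = Finset.univ) => (t : ℕ∞)) _ (Nat.find_spec h)
    calc (propTime G S ω : ℝ≥0∞) ≤ ((s * Nat.find h : ℕ) : ℝ≥0∞) := by
          exact_mod_cast ENat.toENNReal_le.2 hprop
      _ = s * ∑ m ∈ Finset.range (Nat.find h), 1 := by simp
      _ = s * ∑ m ∈ Finset.range (Nat.find h),
            {ω | blue G S ω (s * m) ≠ Finset.univ}.indicator 1 ω := by
          congr 1
          refine Finset.sum_congr rfl fun m hm => ?_
          simp [Nat.find_min h (Finset.mem_range.1 hm)]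
      _ ≤ s * ∑' m : ℕ, {ω | blue G S ω (s * m) ≠ Finset.univ}.indicator 1 ω := by
          gcongr
          exact ENNReal.sum_le_tsum _
  · push Not at h
    simp [h, hs.ne']

lemma eptFrom_le_tsum {s : ℕ} (hs : 0 < s) :
    eptFrom G S ≤ s * ∑' m : ℕ, sampleMeasure V {ω | blue G S ω (s * m) ≠ Finset.univ} := by
  have hmeas (m : ℕ) : MeasurableSet {ω : Sample V | blue G S ω (s * m) ≠ Finset.univ} :=
    measurable_blue G S (s * m) (Set.to_countable {Finset.univ}ᶜ).measurableSet
  calc eptFrom G S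
      ≤ ∫⁻ ω, s * ∑' m : ℕ, {ω | blue G S ω (s * m) ≠ Finset.univ}.indicator 1 ω
          ∂sampleMeasure V := lintegral_mono (propTime_le_tsum hs)
    _ = s * ∑' m : ℕ, sampleMeasure V {ω | blue G S ω (s * m) ≠ Finset.univ} := by
        rw [lintegral_const_mul _ (.tsum fun m => measurable_one.indicator (hmeas m)),
          lintegral_tsum fun m => (measurable_one.indicator (hmeas m)).aemeasurable]
        simp only [lintegral_indicator_one (hmeas _)]

lemma measure_blue_ne_univ_le (t : ℕ) :
    sampleMeasure V {ω | blue G S ω t ≠ Finset.univ} ≤ ∑ v, whiteProb G t v S := by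
  have hunion : {ω : Sample V | blue G S ω t ≠ Finset.univ} = ⋃ v, {ω | v ∉ blue G S ω t} := by
    ext ω
    simp [Finset.eq_univ_iff_forall]
  rw [hunion]
  exact measure_iUnion_fintype_le _ _

lemma eptFrom_le_mul_add_two {s D N : ℕ} (hs : 0 < s)
    (h : ∀ ⦃u v B⦄, G.Adj u v → u ∈ B → whiteProb G s v B ≤ 4⁻¹)
    (hD : ∀ v, ∃ u ∈ S, G.edist u v ≤ D) (hN : Fintype.card V * 4 ^ D ≤ 2 ^ N) :
    eptFrom G S ≤ s * (N + 2) := by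
  have hwhite (m : ℕ) (v : V) : whiteProb G (s * m) v S ≤ 4 ^ D * 2⁻¹ ^ m := by
    obtain ⟨u, hu, huv⟩ := hD v
    obtain ⟨p, hp⟩ := SimpleGraph.exists_walk_of_edist_ne_top
      (huv.trans_lt (ENat.natCast_lt_top D)).ne
    refine (whiteProb_le_of_walk h p hu m).trans ?_
    gcongr
    · norm_num
    · exact_mod_cast hp.trans_le huv
  refine (eptFrom_le_tsum hs).trans ?_
  gcongr
  refine tsum_le_of_le_geometric (fun m => prob_le_one) fun m => ?_
  calc sampleMeasure V {ω | blue G S ω (s * m) ≠ Finset.univ}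
      ≤ ∑ _ : V, 4 ^ D * 2⁻¹ ^ m :=
        (measure_blue_ne_univ_le _).trans (Finset.sum_le_sum fun v _ => hwhite m v)
    _ = (Fintype.card V * 4 ^ D : ℕ) * 2⁻¹ ^ m := by simp [mul_assoc]
    _ ≤ 2 ^ N * 2⁻¹ ^ m := by
        gcongr
        exact_mod_cast hN

end PropTime

section Hypercube

variable {n : ℕ}

lemma degree_hypercube_le (x : Fin n → Bool) : (hypercube n).degree x ≤ n := by
  have hsub : (hypercube n).neighborFinset x ⊆
      Finset.univ.image fun i => Function.update x i (!x i) := by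
    intro y hy
    rw [SimpleGraph.mem_neighborFinset] at hy
    obtain ⟨i, hi⟩ := Finset.card_eq_one.1 (show hammingDist x y = 1 from hy)
    refine Finset.mem_image.2 ⟨i, Finset.mem_univ _, funext fun j => ?_⟩
    have hj : x j ≠ y j ↔ j = i := by simpa using Finset.ext_iff.1 hi j
    obtain rfl | hji := eq_or_ne j i
    · simpa using (Bool.eq_not.2 (hj.2 rfl).symm).symm
    · rw [Function.update_of_ne hji]
      exact not_not.1 fun hne => hji (hj.1 hne)
  rw [← SimpleGraph.card_neighborFinset_eq_degree]
  exact (Finset.card_le_card hsub).trans (Finset.card_image_le.trans (by simp))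

lemma exists_adj_hammingDist_eq_add_one {x y : Fin n → Bool} (h : x ≠ y) :
    ∃ z, (hypercube n).Adj x z ∧ hammingDist x y = hammingDist z y + 1 := by
  obtain ⟨i, hi⟩ := Function.ne_iff.1 h
  refine ⟨Function.update x i (y i), ?_, ?_⟩
  · refine Finset.card_eq_one.2 ⟨i, Finset.ext fun j => ?_⟩
    obtain rfl | hji := eq_or_ne j i
    · simp [hi]
    · simp [hji]
  · unfold hammingDist
    rw [← Finset.card_erase_add_one (a := i) (by simp [hi])]
    congr 2
    ext j
    obtain rfl | hji := eq_or_ne j i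
    · simp
    · simp [hji]

lemma edist_hypercube_le_hammingDist (x y : Fin n → Bool) :
    (hypercube n).edist x y ≤ hammingDist x y := by
  induction hd : hammingDist x y generalizing x with
  | zero => simp [hammingDist_eq_zero.1 hd]
  | succ d ih =>
    have hxy : x ≠ y := hammingDist_ne_zero.1 (hd.trans_ne d.succ_ne_zero)
    obtain ⟨z, hxz, hz⟩ := exists_adj_hammingDist_eq_add_one hxy
    calc (hypercube n).edist x y ≤ (hypercube n).edist x z + (hypercube n).edist z y :=
          SimpleGraph.edist_triangle
      _ ≤ 1 + d := by
          gcongr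
          · exact (SimpleGraph.edist_eq_one_iff_adj.2 hxz).le
          · exact ih z (by omega)
      _ = (d + 1 : ℕ) := by push_cast; ring

lemma edist_hypercube_le (x y : Fin n → Bool) : (hypercube n).edist x y ≤ n :=
  (edist_hypercube_le_hammingDist x y).trans
    (by exact_mod_cast hammingDist_le_card_fintype.trans_eq (Fintype.card_fin n))

lemma add_log_card_le (hn : 2 ≤ n) :
    n + Real.log (Fintype.card (Fin n → Bool)) + 1 ≤ 3 * n := by
  have hcard : Real.log (Fintype.card (Fin n → Bool)) ≤ n := by
    simpa using mul_le_of_le_one_right n.cast_nonneg (by linarith [Real.log_two_lt_d9])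
  linarith [show (2 : ℝ) ≤ n by exact_mod_cast hn]

lemma add_log_card_mul_log_le (hn : 2 ≤ n) :
    54 * ((n + Real.log (Fintype.card (Fin n → Bool)) + 1) * Real.log n) ≤
      162 * (n * Real.log n) := by
  nlinarith [mul_le_mul_of_nonneg_right (add_log_card_le hn) (Real.log_natCast_nonneg n)]

end Hypercube

end ProbZeroForcing

end

open ProbZeroForcing in
theorem theorem3_general {V : Type*} [Fintype V] [DecidableEq V] {G : SimpleGraph V}
    [DecidableRel G.Adj] {S : Finset V} {Δ D : ℕ} (hΔ : 2 ≤ Δ) (hdeg : ∀ u, G.degree u ≤ Δ)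
    (hD : ∀ v, ∃ u ∈ S, G.edist u v ≤ D) :
    eptFrom G S ≤
      ENNReal.ofReal (54 * ((D + Real.log (Fintype.card V) + 1) * Real.log Δ)) := by
  have hΔ' : (2 : ℝ) ≤ Δ := by exact_mod_cast hΔ
  have hlog : 0 < Real.log Δ := Real.log_pos (by linarith)
  set s := ⌈16 * Real.log Δ⌉₊
  set N := 2 * D + Nat.clog 2 (Fintype.card V) with hN_def
  have hs : (s : ℝ) ≤ 18 * Real.log Δ := ceil_sixteen_mul_log_le hΔ'
  have hN : (N : ℝ) + 2 ≤ 3 * (D + Real.log (Fintype.card V) + 1) := by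
    have hlogV := Real.log_natCast_nonneg (Fintype.card V)
    have hclog := clog_two_le (Fintype.card V)
    push_cast [hN_def]
    linarith [D.cast_nonneg (α := ℝ)]
  calc eptFrom G S ≤ s * (N + 2) :=
        eptFrom_le_mul_add_two (Nat.ceil_pos.2 (by positivity))
          (fun _ _ _ huv hu => whiteProb_ceil_log_le hΔ hdeg hu huv) hD
          (mul_four_pow_le_two_pow _ D)
    _ = ENNReal.ofReal (s * (N + 2)) := by
        rw [ENNReal.ofReal_mul (Nat.cast_nonneg _), ENNReal.ofReal_add (by positivity) (by simp)]
        simp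
    _ ≤ ENNReal.ofReal (18 * Real.log Δ * (3 * (D + Real.log (Fintype.card V) + 1))) := by gcongr
    _ = _ := by ring_nf

theorem theorem3 :
    ∃ C : ℝ, 0 < C ∧ ∀ n : ℕ, 2 ≤ n →
      ProbZeroForcing.ept (ProbZeroForcing.hypercube n) ≤
        ENNReal.ofReal (C * ((n : ℝ) * Real.log (n : ℝ))) := by
  open ProbZeroForcing in
  exact ⟨162, by norm_num, fun n hn => (iInf_le _ default).trans <|
    (theorem3_general hn degree_hypercube_le fun v =>
      ⟨default, Finset.mem_singleton_self _, edist_hypercube_le _ v⟩).trans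
    (ENNReal.ofReal_le_ofReal (add_log_card_mul_log_le hn))⟩
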